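/- Let $\alpha,\beta>-1$, let $j\ge 0$ be an integer, let $\gamma\in\mathbb{R}$ and $M>0$, and let $\{M_n\}_{n\ge 0}$ be a sequence of nonnegative real numbers with $\lim_{n\to\infty}M_n n^{\gamma}=M$. For real polynomials $f,g$ put $$(f,g)=\int_{-1}^1 f(x)g(x)(1-x)^{\alpha}(1+x)^{\beta}\,dx,\qquad (f,g)_{S,n}=(f,g)+M_n f^{(j)}(1)g^{(j)}(1).$$ Let $P_n^{(\alpha,\beta)}$ be the Jacobi polynomial of degree $n$, i.e. the polynomial of degree $n$ that is orthogonal with respect to $(\cdot,\cdot)$ to all polynomials of degree less than $n$ and is normalized by $P_n^{(\alpha,\beta)}(1)=\frac{\Gamma(n+\alpha+1)}{\Gamma(n+1)\Gamma(\alpha+1)}$, and write $\|P_n^{(\alpha,\beta)}\|^2=(P_n^{(\alpha,\beta)},P_n^{(\alpha,\beta)})$. Let $Q_n$ be the polynomial of degree $n$ that has the same leading coefficient as $P_n^{(\alpha,\beta)}$ and is orthogonal with respect to $(\cdot,\cdot)_{S,n}$ to all polynomials of degree less than $n$. Then: (a) For every fixed integer $k\ge 0$ (the quotient being considered for $n\ge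 k$), $$\lim_{n\to\infty}\frac{Q_n^{(k)}(1)}{\bigl(P_n^{(\alpha,\beta)}\bigr)^{(k)}(1)}=\begin{cases}\dfrac{k-j}{\alpha+j+k+1}, & \gamma<2(\alpha+2j+1),\\[2mm] \theta_{\alpha,\beta,j,k}, & \gamma=2(\alpha+2j+1),\\[1mm] 1, & \gamma>2(\alpha+2j+1),\end{cases}$$ where $$\theta_{\alpha,\beta,j,k}=\frac{M(k-j)+\Gamma(\alpha+j+1)^2\,2^{\alpha+\beta+2j+1}(\alpha+2j+1)(\alpha+j+k+1)}{(\alpha+j+k+1)\left(M+\Gamma(\alpha+j+1)^2\,2^{\alpha+\beta+2j+1}(\alpha+2j+1)\right)}.$$ (b) $\displaystyle\lim_{n\to\infty}\frac{(Q_n,Q_n)_{S,n}}{\|P_n^{(\alpha,\beta)}\|^2}=1.$ -/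

import Mathlib

open Filter Topology Polynomial

noncomputable section

/-- The Jacobi inner product `∫_{-1}^{1} f(x) g(x) (1 - x)^α (1 + x)^β dx` on real polynomials. -/
def jacobiInner (α β : ℝ) (f g : ℝ[X]) : ℝ :=
  ∫ x in (-1 : ℝ)..1, f.eval x * g.eval x * (1 - x) ^ α * (1 + x) ^ β

/-- The discrete Jacobi--Sobolev inner product with mass `m`: the Jacobi inner product plus
`m f⁽ʲ⁾(1) g⁽ʲ⁾(1)`. -/
def sobolevInner (α β : ℝ) (j : ℕ) (m : ℝ) (f g : ℝ[X]) : ℝ :=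
  jacobiInner α β f g + m * (derivative^[j] f).eval 1 * (derivative^[j] g).eval 1

/-- `p` is an orthogonal polynomial of degree `n` for the form `B`: its degree is exactly `n` and
it is orthogonal to every polynomial of smaller degree. -/
def IsOrthogonalPoly (B : ℝ[X] → ℝ[X] → ℝ) (n : ℕ) (p : ℝ[X]) : Prop :=
  p.degree = n ∧ ∀ q : ℝ[X], q.degree < n → B p q = 0

/-- `p` is the Jacobi polynomial of degree `n`: the orthogonal polynomial of degree `n` for the
Jacobi inner product, normalized by `p(1) = Γ(n+α+1) / (Γ(n+1) Γ(α+1))`. -/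
def IsJacobiPoly (α β : ℝ) (n : ℕ) (p : ℝ[X]) : Prop :=
  IsOrthogonalPoly (jacobiInner α β) n p ∧
    p.eval 1 = Real.Gamma (n + α + 1) / (Real.Gamma (n + 1) * Real.Gamma (α + 1))

/-- The Jacobi polynomial `P_n^{(α,β)}`, that is, the polynomial satisfying `IsJacobiPoly`
(for `α, β > -1` there is exactly one). -/
def jacobiP (α β : ℝ) (n : ℕ) : ℝ[X] :=
  Classical.epsilon (IsJacobiPoly α β n)

/-- `q` is the Jacobi--Sobolev polynomial of degree `n` for the mass `m`: the orthogonal polynomial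
of degree `n` for the Sobolev inner product, with the leading coefficient of `P_n^{(α,β)}`. -/
def IsSobolevPoly (α β : ℝ) (j : ℕ) (m : ℝ) (n : ℕ) (q : ℝ[X]) : Prop :=
  IsOrthogonalPoly (sobolevInner α β j m) n q ∧
    q.leadingCoeff = (jacobiP α β n).leadingCoeff

/-- The Jacobi--Sobolev polynomial `Q_n^{(α,β,m)}`, that is, the polynomial satisfying
`IsSobolevPoly` (for `α, β > -1` and `m ≥ 0` there is exactly one). -/
def sobolevQ (α β : ℝ) (j : ℕ) (m : ℝ) (n : ℕ) : ℝ[X] :=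
  Classical.epsilon (IsSobolevPoly α β j m n)

/-- The limit constant `θ_{α,β,j,k}` of the critical case; it also depends on `M`. -/
def thetaConst (α β M : ℝ) (j k : ℕ) : ℝ :=
  (M * ((k : ℝ) - j) +
      Real.Gamma (α + j + 1) ^ 2 * (2 : ℝ) ^ (α + β + 2 * j + 1) * (α + 2 * j + 1) *
        (α + j + k + 1)) /
    ((α + j + k + 1) *
      (M + Real.Gamma (α + j + 1) ^ 2 * (2 : ℝ) ^ (α + β + 2 * j + 1) * (α + 2 * j + 1)))

end

/-! Let `K` be the `j`-th derivative at `1`, in one variable, of the reproducing kernel for degrees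
below `n`. Orthogonality forces `Q_n = P_n - c K` with `c = m P_n⁽ʲ⁾(1) / (1 + m K⁽ʲ⁾(1))`
(`sobolevQ_eq`), so everything reduces to asymptotics of derivatives at `1`.

The Jacobi operator, symmetric by integration by parts, shows that derivatives of Jacobi polynomials
are orthogonal for shifted parameters. This yields recursions for `P_n⁽ᵏ⁾(1)`, of order `n ^ (2k +
α)`, and for the squared norm, asymptotic to `2 ^ (α + β) / n`. Stolz–Cesàro summation then gives
the size of `K⁽ᵏ⁾(1)`.

In `P_n⁽ʲ⁾(1) K⁽ᵏ⁾(1) / P_n⁽ᵏ⁾(1)` the power of `n` is `2(α + 2j + 1)` for every `k`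
(`tendsto_kernel_ratio`). Whether `m` times this power tends to infinity, to `M` or to `0` decides
the three cases of (a). For (b), the excess of the norm quotient over `1` is at most the next term
of the kernel sum divided by the sum itself, which is `O(1/n)`. -/

/-! ### The Jacobi inner product: integrability and positivity. -/

open MeasureTheory Set in
theorem intervalIntegrable_one_sub_rpow_mul_one_add_rpow {α β : ℝ} (hα : -1 < α) (hβ : -1 < β) :
    IntervalIntegrable (fun x : ℝ => (1 - x) ^ α * (1 + x) ^ β) volume (-1) 1 := by
  -- On `[-1, 0]` only the endpoint `-1` can be singular; the other half follows by `x ↦ -x`, which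
  -- swaps the exponents.
  have key : ∀ a b : ℝ, -1 < b →
      IntervalIntegrable (fun x : ℝ => (1 - x) ^ a * (1 + x) ^ b) volume (-1) 0 := by
    intro a b hb
    refine IntervalIntegrable.continuousOn_mul ?_ ?_
    · have := (intervalIntegral.intervalIntegrable_rpow' (a := 0) (b := 1) hb).comp_add_left 1
      simpa using this
    · refine ContinuousOn.rpow_const (by fun_prop) fun x hx => Or.inl ?_
      rw [uIcc_of_le (by norm_num)] at hx
      linarith [hx.2]
  refine (key α β hβ).trans ?_
  have := ((key β α hα).comp_sub_left 0).symm
  simpa [mul_comm, ← sub_eq_add_neg] using this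

open MeasureTheory Set in
theorem intervalIntegrable_jacobi {α β : ℝ} (hα : -1 < α) (hβ : -1 < β) (f g : ℝ[X]) :
    IntervalIntegrable (fun x : ℝ => f.eval x * g.eval x * (1 - x) ^ α * (1 + x) ^ β)
      volume (-1) 1 := by
  have := (intervalIntegrable_one_sub_rpow_mul_one_add_rpow hα hβ).continuousOn_mul
    (g := fun x => f.eval x * g.eval x) (by fun_prop)
  simpa [mul_assoc] using this

theorem jacobiInner_comm (α β : ℝ) (f g : ℝ[X]) : jacobiInner α β f g = jacobiInner α β g f := by
  simp only [jacobiInner, mul_comm (f.eval _)]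

theorem jacobiInner_add_left {α β : ℝ} (hα : -1 < α) (hβ : -1 < β) (f g h : ℝ[X]) :
    jacobiInner α β (f + g) h = jacobiInner α β f h + jacobiInner α β g h := by
  rw [jacobiInner, jacobiInner, jacobiInner, ← intervalIntegral.integral_add
    (intervalIntegrable_jacobi hα hβ f h) (intervalIntegrable_jacobi hα hβ g h)]
  simp only [eval_add, add_mul]

theorem jacobiInner_smul_left (α β c : ℝ) (f g : ℝ[X]) :
    jacobiInner α β (c • f) g = c * jacobiInner α β f g := by
  rw [jacobiInner, jacobiInner, ← intervalIntegral.integral_const_mul]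
  simp only [eval_smul, smul_eq_mul, mul_assoc]

/-- The Jacobi inner product as a bilinear form. -/
noncomputable def jacobiForm {α β : ℝ} (hα : -1 < α) (hβ : -1 < β) : LinearMap.BilinForm ℝ ℝ[X] :=
  LinearMap.mk₂ ℝ (jacobiInner α β) (jacobiInner_add_left hα hβ) (jacobiInner_smul_left α β)
    (fun f g h => by
      rw [jacobiInner_comm, jacobiInner_add_left hα hβ, jacobiInner_comm _ _ g,
        jacobiInner_comm _ _ h])
    (fun c f g => by rw [jacobiInner_comm, jacobiInner_smul_left, jacobiInner_comm, smul_eq_mul])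

theorem jacobiForm_apply {α β : ℝ} (hα : -1 < α) (hβ : -1 < β) (f g : ℝ[X]) :
    jacobiForm hα hβ f g = jacobiInner α β f g := rfl

open MeasureTheory Set in
theorem jacobiInner_self_pos {α β : ℝ} (hα : -1 < α) (hβ : -1 < β) {f : ℝ[X]} (hf : f ≠ 0) :
    0 < jacobiInner α β f f := by
  have hnn : ∀ x ∈ Ioo (-1 : ℝ) 1,
      0 ≤ f.eval x * f.eval x * (1 - x) ^ α * (1 + x) ^ β := fun x hx => by
    have h₁ : 0 < 1 - x := by linarith [hx.2]
    have h₂ : 0 < 1 + x := by linarith [hx.1]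
    have := mul_self_nonneg (f.eval x)
    positivity
  have hnn' : 0 ≤ᵐ[volume.restrict (Ioc (-1 : ℝ) 1)]
      fun x => f.eval x * f.eval x * (1 - x) ^ α * (1 + x) ^ β := by
    rw [← restrict_Ioo_eq_restrict_Ioc]
    exact (ae_restrict_mem measurableSet_Ioo).mono hnn
  rw [jacobiInner, intervalIntegral.integral_pos_iff_support_of_nonneg_ae' (by
    rwa [uIoc_of_le (by norm_num)]) (intervalIntegrable_jacobi hα hβ f f)]
  refine ⟨by norm_num, ?_⟩
  have hsub : Ioo (-1 : ℝ) 1 \ f.rootSet ℝ ⊆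
      Function.support (fun x => f.eval x * f.eval x * (1 - x) ^ α * (1 + x) ^ β) ∩
        Ioc (-1) 1 := by
    rintro x ⟨hx, hxr⟩
    refine ⟨?_, Ioo_subset_Ioc_self hx⟩
    have h₁ : 0 < 1 - x := by linarith [hx.2]
    have h₂ : 0 < 1 + x := by linarith [hx.1]
    have h₃ : f.eval x ≠ 0 := fun h => hxr (by simp [mem_rootSet, hf, h])
    have := (Real.rpow_pos_of_pos h₁ α).ne'
    have := (Real.rpow_pos_of_pos h₂ β).ne'
    simp_all
  refine lt_of_lt_of_le ?_ (measure_mono hsub)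
  rw [measure_sdiff_null ((f.rootSet_finite ℝ).measure_zero _)]
  simp

/-! ### The Jacobi differential operator and its consequences. -/

/-- The differential operator `(1 - x²) f'' + (β - α - (α + β + 2) x) f'`, of which the Jacobi
polynomials are the eigenfunctions. -/
noncomputable def jacobiOp (α β : ℝ) (f : ℝ[X]) : ℝ[X] :=
  (1 - X ^ 2) * derivative (derivative f) + (C (β - α) - C (α + β + 2) * X) * derivative f

-- The weight times `jacobiOp α β f` is the derivative of `(1 - x)^(α+1) (1 + x)^(β+1) f'`.
-- Integration by parts leaves no boundary term because `α + 1` and `β + 1` are positive.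
open MeasureTheory Set in
theorem jacobiInner_jacobiOp {α β : ℝ} (hα : -1 < α) (hβ : -1 < β) (f g : ℝ[X]) :
    jacobiInner α β (jacobiOp α β f) g =
      -jacobiInner (α + 1) (β + 1) (derivative f) (derivative g) := by
  set F : ℝ → ℝ := fun x => (derivative f).eval x * g.eval x * ((1 - x) ^ (α + 1) *
    (1 + x) ^ (β + 1)) with hF
  have hi₁ := intervalIntegrable_jacobi hα hβ (jacobiOp α β f) g
  have hi₂ := intervalIntegrable_jacobi (α := α + 1) (β := β + 1) (by linarith) (by linarith)
    (derivative f) (derivative g)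
  have hcont : ContinuousOn F (Icc (-1) 1) := by
    refine ContinuousOn.mul (by fun_prop) (ContinuousOn.mul ?_ ?_)
    · exact ContinuousOn.rpow_const (by fun_prop) fun x _ => Or.inr (by linarith)
    · exact ContinuousOn.rpow_const (by fun_prop) fun x _ => Or.inr (by linarith)
  have hder : ∀ x ∈ Ioo (-1 : ℝ) 1, HasDerivAt F
      ((jacobiOp α β f).eval x * g.eval x * (1 - x) ^ α * (1 + x) ^ β +
        (derivative f).eval x * (derivative g).eval x * (1 - x) ^ (α + 1) *
          (1 + x) ^ (β + 1)) x := by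
    intro x hx
    have h₁ : 0 < 1 - x := by linarith [hx.2]
    have h₂ : 0 < 1 + x := by linarith [hx.1]
    have d₁ : HasDerivAt (fun y : ℝ => (1 - y) ^ (α + 1)) (-1 * (α + 1) * (1 - x) ^ α) x := by
      simpa using ((hasDerivAt_id x).const_sub 1).rpow_const (p := α + 1) (Or.inl h₁.ne')
    have d₂ : HasDerivAt (fun y : ℝ => (1 + y) ^ (β + 1)) (1 * (β + 1) * (1 + x) ^ β) x := by
      simpa using ((hasDerivAt_id x).const_add 1).rpow_const (p := β + 1) (Or.inl h₂.ne')
    refine ((((derivative f).hasDerivAt x).mul (g.hasDerivAt x)).mul (d₁.mul d₂)).congr_deriv ?_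
    simp only [Pi.mul_apply, Real.rpow_add_one h₁.ne', Real.rpow_add_one h₂.ne', jacobiOp, eval_add,
      eval_mul, eval_sub, eval_one, eval_pow, eval_X, eval_C]
    ring
  have := intervalIntegral.integral_eq_sub_of_hasDerivAt_of_le (by norm_num) hcont hder
    (hi₁.add hi₂)
  rw [intervalIntegral.integral_add hi₁ hi₂] at this
  have e₁ : F 1 = 0 := by
    simp [hF, Real.zero_rpow (show α + 1 ≠ 0 by linarith)]
  have e₂ : F (-1) = 0 := by
    simp [hF, Real.zero_rpow (show β + 1 ≠ 0 by linarith)]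
  rw [e₁, e₂, sub_zero] at this
  exact eq_neg_of_add_eq_zero_left this

theorem coeff_jacobiOp (α β : ℝ) (f : ℝ[X]) (m : ℕ) :
    (jacobiOp α β f).coeff m = (m + 2) * (m + 1) * f.coeff (m + 2) +
      (β - α) * (m + 1) * f.coeff (m + 1) - m * (m + α + β + 1) * f.coeff m := by
  have h : jacobiOp α β f = derivative (derivative f) - X * (X * derivative (derivative f)) +
      (C (β - α) * derivative f - C (α + β + 2) * (X * derivative f)) := by
    rw [jacobiOp]; ring
  rw [h]
  rcases m with _ | _ | m <;>
    simp only [coeff_add, coeff_sub, coeff_C_mul, coeff_X_mul_zero, coeff_X_mul, coeff_derivative] <;>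
    push_cast <;> ring

theorem degree_jacobiOp_lt {α β : ℝ} {f : ℝ[X]} {n : ℕ} (hf : f.degree < n) :
    (jacobiOp α β f).degree < n := by
  rw [degree_lt_iff_coeff_zero] at hf ⊢
  intro m hm
  rw [coeff_jacobiOp, hf m hm, hf (m + 1) (by omega), hf (m + 2) (by omega)]
  ring

theorem degree_jacobiOp_add_lt {α β : ℝ} {f : ℝ[X]} {n : ℕ} (hf : f.degree = n) :
    (jacobiOp α β f + ((n : ℝ) * (n + α + β + 1)) • f).degree < n := by
  have hf' : ∀ m, n + 1 ≤ m → f.coeff m = 0 := by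
    rw [← degree_lt_iff_coeff_zero, hf]; exact_mod_cast n.lt_succ_self
  rw [degree_lt_iff_coeff_zero]
  intro m hm
  rw [coeff_add, coeff_jacobiOp, coeff_smul, hf' (m + 1) (by omega), hf' (m + 2) (by omega)]
  rcases hm.eq_or_lt with rfl | h
  · simp
  · simp [hf' m h]

theorem exists_derivative_eq (q : ℝ[X]) (n : ℕ) (hq : q.degree < n) :
    ∃ g : ℝ[X], derivative g = q ∧ g.degree < (n + 1 : ℕ) := by
  refine ⟨∑ i ∈ Finset.range n, C (q.coeff i / (i + 1)) * X ^ (i + 1), ?_, ?_⟩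
  · rw [derivative_sum]
    ext m
    simp only [derivative_C_mul_X_pow, finsetSum_coeff, coeff_C_mul_X_pow, Nat.add_sub_cancel,
      Finset.sum_ite_eq, Finset.mem_range]
    split_ifs with h
    · push_cast
      field_simp
    · exact ((degree_lt_iff_coeff_zero q n).1 hq m (by omega)).symm
  · rw [degree_lt_iff_coeff_zero]
    intro m hm
    simp only [finsetSum_coeff, coeff_C_mul_X_pow]
    refine Finset.sum_eq_zero fun i hi => if_neg ?_
    have := Finset.mem_range.1 hi
    omega

/-- A test polynomial is some `g'`, and integration by parts turns the pairing into that of `p` with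
`jacobiOp α β g`, whose degree is still too small to see `p`. -/
theorem isOrthogonalPoly_derivative {α β : ℝ} (hα : -1 < α) (hβ : -1 < β) {n : ℕ} {p : ℝ[X]}
    (hp : IsOrthogonalPoly (jacobiInner α β) (n + 1) p) :
    IsOrthogonalPoly (jacobiInner (α + 1) (β + 1)) n (derivative p) := by
  refine ⟨?_, fun q hq => ?_⟩
  · have h := natDegree_eq_of_degree_eq_some hp.1
    rw [degree_derivative (by omega), h, Nat.add_sub_cancel]
  · obtain ⟨g, rfl, hg⟩ := exists_derivative_eq q n hq
    have := jacobiInner_jacobiOp hα hβ g p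
    rw [jacobiInner_comm, hp.2 _ (degree_jacobiOp_lt hg), jacobiInner_comm] at this
    linarith

/-- The remainder `r` has degree below `n`. By symmetry of the operator it is orthogonal to both of
its summands, hence to itself. -/
theorem jacobiOp_eq {α β : ℝ} (hα : -1 < α) (hβ : -1 < β) {n : ℕ} {p : ℝ[X]}
    (hp : IsOrthogonalPoly (jacobiInner α β) n p) :
    jacobiOp α β p = (-((n : ℝ) * (n + α + β + 1))) • p := by
  have hd := degree_jacobiOp_add_lt (α := α) (β := β) hp.1
  set r := jacobiOp α β p + ((n : ℝ) * (n + α + β + 1)) • p with hr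
  suffices r = 0 by rw [neg_smul]; exact eq_neg_of_add_eq_zero_left this
  by_contra h
  refine (jacobiInner_self_pos hα hβ h).ne' ?_
  conv_lhs => arg 3; rw [hr]
  rw [jacobiInner_add_left hα hβ, jacobiInner_smul_left, hp.2 r hd, mul_zero, add_zero,
    jacobiInner_jacobiOp hα hβ, jacobiInner_comm, ← jacobiInner_jacobiOp hα hβ, jacobiInner_comm]
  exact hp.2 _ (degree_jacobiOp_lt hd)

/-- At `x = 1` the second-order term of the eigenvalue equation vanishes. -/
theorem eval_one_derivative {α β : ℝ} (hα : -1 < α) (hβ : -1 < β) {n : ℕ} {p : ℝ[X]}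
    (hp : IsOrthogonalPoly (jacobiInner α β) n p) :
    2 * (α + 1) * (derivative p).eval 1 = n * (n + α + β + 1) * p.eval 1 := by
  have := congrArg (eval 1) (jacobiOp_eq hα hβ hp)
  simp only [jacobiOp, eval_add, eval_mul, eval_sub, eval_one, eval_pow, eval_X, eval_C, eval_smul,
    smul_eq_mul] at this
  linarith

theorem jacobiInner_derivative_self {α β : ℝ} (hα : -1 < α) (hβ : -1 < β) {n : ℕ} {p : ℝ[X]}
    (hp : IsOrthogonalPoly (jacobiInner α β) n p) :
    jacobiInner (α + 1) (β + 1) (derivative p) (derivative p) =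
      n * (n + α + β + 1) * jacobiInner α β p p := by
  have := jacobiInner_jacobiOp hα hβ p p
  rw [jacobiOp_eq hα hβ hp, jacobiInner_smul_left] at this
  linarith

/-- This makes the normalization at `1` possible. A zero at `1` would pass to every derivative, down
to a nonzero constant. -/
theorem eval_one_ne_zero {n : ℕ} : ∀ {α β : ℝ} {p : ℝ[X]}, -1 < α → -1 < β →
    IsOrthogonalPoly (jacobiInner α β) n p → p.eval 1 ≠ 0 := by
  induction n with
  | zero =>
    intro α β p _ _ hp h
    have h0 := hp.1
    rw [eq_C_of_degree_eq_zero h0, eval_C] at h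
    rw [eq_C_of_degree_eq_zero h0, h] at h0
    simp at h0
  | succ n ih =>
    intro α β p hα hβ hp h
    have := eval_one_derivative hα hβ hp
    rw [h, mul_zero] at this
    refine ih (by linarith) (by linarith) (isOrthogonalPoly_derivative hα hβ hp) ?_
    simpa [show α + 1 ≠ 0 by linarith] using this

/-! ### Existence of the Jacobi polynomials and their norms. -/

theorem jacobiInner_one_one {α β : ℝ} (hα : -1 < α) (hβ : -1 < β) :
    jacobiInner α β 1 1 = 2 ^ (α + β + 1) * (Real.Gamma (α + 1) * Real.Gamma (β + 1) /
      Real.Gamma (α + β + 2)) := by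
  have hb := ProbabilityTheory.beta_eq_betaIntegralReal (α + 1) (β + 1) (by linarith) (by linarith)
  have h : Complex.betaIntegral ((α + 1 : ℝ) : ℂ) ((β + 1 : ℝ) : ℂ) =
      ((∫ x in (0 : ℝ)..1, x ^ α * (1 - x) ^ β : ℝ) : ℂ) := by
    rw [Complex.betaIntegral, ← intervalIntegral.integral_ofReal]
    refine intervalIntegral.integral_congr fun x hx => ?_
    rw [Set.uIcc_of_le zero_le_one] at hx
    push_cast
    rw [Complex.ofReal_cpow hx.1, Complex.ofReal_cpow (by linarith [hx.2])]
    push_cast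
    simp only [add_sub_cancel_right]
  rw [h, Complex.ofReal_re, ProbabilityTheory.beta,
    show α + 1 + (β + 1) = α + β + 2 by ring] at hb
  rw [hb, jacobiInner]
  -- The substitution `x = 1 - 2t` turns the integral into a beta integral.
  have hs := intervalIntegral.integral_comp_sub_mul
    (fun x : ℝ => (1 - x) ^ α * (1 + x) ^ β) (a := 0) (b := 1) two_ne_zero 1
  norm_num at hs
  simp only [eval_one, mul_one, one_mul]
  rw [← mul_right_inj' (show (1 / 2 : ℝ) ≠ 0 by norm_num), ← hs,
    ← intervalIntegral.integral_const_mul, ← intervalIntegral.integral_const_mul]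
  refine intervalIntegral.integral_congr fun x hx => ?_
  rw [Set.uIcc_of_le zero_le_one] at hx
  have e : (1 : ℝ) + (1 - 2 * x) = 2 * (1 - x) := by ring
  simp only [e]
  rw [Real.mul_rpow two_pos.le hx.1, Real.mul_rpow two_pos.le (by linarith [hx.2]),
    Real.rpow_add_one two_ne_zero, Real.rpow_add two_pos]
  ring

/-- Positive definiteness makes the Gram map injective, hence onto the dual, so `X ^ n` has an
orthogonal projection to subtract. -/
theorem exists_isOrthogonalPoly {α β : ℝ} (hα : -1 < α) (hβ : -1 < β) (n : ℕ) :
    ∃ p, IsOrthogonalPoly (jacobiInner α β) n p := by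
  have : FiniteDimensional ℝ (degreeLT ℝ n) := (degreeLTEquiv ℝ n).symm.finiteDimensional
  let φ : degreeLT ℝ n →ₗ[ℝ] Module.Dual ℝ (degreeLT ℝ n) :=
    (jacobiForm hα hβ).restrict (degreeLT ℝ n)
  have hinj : Function.Injective φ := by
    refine (injective_iff_map_eq_zero φ).2 fun f hf => ?_
    by_contra h
    exact (jacobiInner_self_pos hα hβ (fun h0 => h (Subtype.ext h0))).ne'
      (LinearMap.congr_fun hf f)
  obtain ⟨⟨q, hq⟩, h⟩ := (LinearMap.injective_iff_surjective_of_finrank_eq_finrank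
    Subspace.dual_finrank_eq.symm).1 hinj
      ((jacobiForm hα hβ (X ^ n)).domRestrict (degreeLT ℝ n))
  refine ⟨X ^ n - q, ?_, fun g hg => ?_⟩
  · rw [mem_degreeLT] at hq
    rw [degree_sub_eq_left_of_degree_lt] <;> simp [hq]
  · have h' : jacobiForm hα hβ q g = jacobiForm hα hβ (X ^ n) g :=
      LinearMap.congr_fun h ⟨g, mem_degreeLT.2 hg⟩
    rw [← jacobiForm_apply hα hβ, map_sub, LinearMap.sub_apply, h', sub_self]

theorem isJacobiPoly_jacobiP {α β : ℝ} (hα : -1 < α) (hβ : -1 < β) (n : ℕ) :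
    IsJacobiPoly α β n (jacobiP α β n) := by
  refine Classical.epsilon_spec (p := IsJacobiPoly α β n) ?_
  obtain ⟨p, hp⟩ := exists_isOrthogonalPoly hα hβ n
  have h1 := eval_one_ne_zero hα hβ hp
  set v := Real.Gamma (n + α + 1) / (Real.Gamma (n + 1) * Real.Gamma (α + 1)) with hv
  have hv0 : v ≠ 0 := by
    have h₁ : 0 < Real.Gamma (n + α + 1) := Real.Gamma_pos_of_pos (by
      have : (0 : ℝ) ≤ n := n.cast_nonneg
      linarith)
    have h₂ : 0 < Real.Gamma (n + 1) := Real.Gamma_pos_of_pos (by positivity)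
    have h₃ : 0 < Real.Gamma (α + 1) := Real.Gamma_pos_of_pos (by linarith)
    positivity
  refine ⟨(v / p.eval 1) • p, ⟨?_, fun q hq => ?_⟩, ?_⟩
  · rw [degree_smul_of_smul_regular _ (IsSMulRegular.of_ne_zero (div_ne_zero hv0 h1)), hp.1]
  · rw [jacobiInner_smul_left, hp.2 q hq, mul_zero]
  · rw [eval_smul, smul_eq_mul, div_mul_cancel₀ _ h1]

/-- Differentiation lowers the degree and shifts the parameters, with known effect on the norm and
on the value at `1`. The induction starts at degree one since in degree zero the factor `(α + β + 1)
Γ(α + β + 1)` degenerates when `α + β = -1`. -/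
theorem jacobiInner_self_eq (n : ℕ) : ∀ {α β : ℝ} {p : ℝ[X]}, -1 < α → -1 < β →
    IsOrthogonalPoly (jacobiInner α β) (n + 1) p →
    jacobiInner α β p p = p.eval 1 ^ 2 * (2 ^ (α + β + 1) * Real.Gamma (n + β + 2) *
      (n + 1).factorial * Real.Gamma (α + 1) ^ 2 /
        ((2 * n + α + β + 3) * Real.Gamma (n + α + β + 2) * Real.Gamma (n + α + 2))) := by
  induction n with
  | zero =>
    intro α β p hα hβ hp
    have h1 := eval_one_derivative hα hβ hp
    have h2 := jacobiInner_derivative_self hα hβ hp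
    have hd := (isOrthogonalPoly_derivative hα hβ hp).1
    obtain ⟨c, hc⟩ : ∃ c : ℝ, derivative p = c • 1 :=
      ⟨_, by rw [eq_C_of_degree_eq_zero hd, smul_eq_C_mul, mul_one]⟩
    rw [hc, jacobiInner_smul_left, jacobiInner_comm, jacobiInner_smul_left,
      jacobiInner_one_one (by linarith) (by linarith)] at h2
    rw [hc, eval_smul, eval_one, smul_eq_mul, mul_one] at h1
    have g1 : Real.Gamma (α + 1 + 1) = (α + 1) * Real.Gamma (α + 1) :=
      Real.Gamma_add_one (by linarith)
    have g2 : Real.Gamma (α + 1 + (β + 1) + 2) =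
        (α + β + 3) * ((α + β + 2) * Real.Gamma (α + β + 2)) := by
      rw [← Real.Gamma_add_one (by linarith), show α + 1 + (β + 1) + 2 = α + β + 3 + 1 by ring,
        Real.Gamma_add_one (by linarith)]
      ring_nf
    have g3 : (2 : ℝ) ^ (α + 1 + (β + 1) + 1) = 4 * 2 ^ (α + β + 1) := by
      rw [show α + 1 + (β + 1) + 1 = α + β + 1 + 2 by ring, Real.rpow_add two_pos]
      norm_num
      ring
    have hG1 : 0 < Real.Gamma (α + 1) := Real.Gamma_pos_of_pos (by linarith)
    have hG2 : 0 < Real.Gamma (α + β + 2) := Real.Gamma_pos_of_pos (by linarith)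
    rw [g1, g2, g3] at h2
    push_cast at h1 h2 ⊢
    simp only [zero_add, mul_zero, Nat.factorial_one, Nat.cast_one, mul_one, one_mul] at h1 h2 ⊢
    rw [show α + 2 = α + 1 + 1 by ring, g1, show β + 2 = β + 1 + 1 by ring]
    have ha : α + 1 ≠ 0 := by linarith
    have hab : α + β + 2 ≠ 0 := by linarith
    have hab' : α + β + 3 ≠ 0 := by linarith
    have hc' : c = (α + β + 2) * p.eval 1 / (2 * (α + 1)) := by
      field_simp
      linarith
    rw [hc', show 1 + α + β + 1 = α + β + 2 by ring] at h2
    rw [eq_comm, ← mul_left_cancel_iff_of_pos (show 0 < α + β + 2 by linarith), ← h2]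
    field_simp
    ring
  | succ n ih =>
    intro α β p hα hβ hp
    have h1 := eval_one_derivative hα hβ hp
    have h2 := jacobiInner_derivative_self hα hβ hp
    rw [ih (by linarith) (by linarith) (isOrthogonalPoly_derivative hα hβ hp)] at h2
    have hn : (0 : ℝ) ≤ n := n.cast_nonneg
    have g1 : Real.Gamma (α + 1 + 1) = (α + 1) * Real.Gamma (α + 1) :=
      Real.Gamma_add_one (by linarith)
    have g2 : Real.Gamma (n + (α + 1) + (β + 1) + 2) =
        (n + α + β + 3) * Real.Gamma (n + α + β + 3) := by
      rw [← Real.Gamma_add_one (by linarith)]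
      ring_nf
    have g3 : (2 : ℝ) ^ (α + 1 + (β + 1) + 1) = 4 * 2 ^ (α + β + 1) := by
      rw [show α + 1 + (β + 1) + 1 = α + β + 1 + 2 by ring, Real.rpow_add two_pos]
      norm_num
      ring
    have hG1 : 0 < Real.Gamma (α + 1) := Real.Gamma_pos_of_pos (by linarith)
    have hG2 : 0 < Real.Gamma (n + α + β + 3) := Real.Gamma_pos_of_pos (by linarith)
    have hG3 : 0 < Real.Gamma (n + α + 3) := Real.Gamma_pos_of_pos (by linarith)
    rw [g1, g2, g3, show (n : ℝ) + (β + 1) + 2 = n + β + 3 by ring,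
      show (n : ℝ) + (α + 1) + 2 = n + α + 3 by ring] at h2
    rw [Nat.factorial_succ (n + 1)]
    push_cast at h1 h2 ⊢
    rw [show (n : ℝ) + 1 + β + 2 = n + β + 3 by ring, show (n : ℝ) + 1 + α + 2 = n + α + 3 by ring,
      show (n : ℝ) + 1 + α + β + 2 = n + α + β + 3 by ring]
    have ha : α + 1 ≠ 0 := by linarith
    have hab : (n : ℝ) + α + β + 3 ≠ 0 := by linarith
    have hab' : 2 * (n : ℝ) + α + β + 5 ≠ 0 := by linarith
    have hc' : (derivative p).eval 1 =
        (n + 2) * (n + α + β + 3) * p.eval 1 / (2 * (α + 1)) := by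
      field_simp
      linarith
    rw [hc', show 2 * (n : ℝ) + (α + 1) + (β + 1) + 3 = 2 * n + α + β + 5 by ring,
      show ((n : ℝ) + 1 + 1) * (n + 1 + 1 + α + β + 1) = (n + 2) * (n + α + β + 3) by ring] at h2
    rw [show 2 * ((n : ℝ) + 1) + α + β + 3 = 2 * n + α + β + 5 by ring, eq_comm,
      ← mul_left_cancel_iff_of_pos (show 0 < ((n : ℝ) + 2) * (n + α + β + 3) by
        exact mul_pos (by linarith) (by linarith)), ← h2]
    field_simp
    ring

section

variable {α β : ℝ}

theorem jacobiP_ne_zero (hα : -1 < α) (hβ : -1 < β) (n : ℕ) : jacobiP α β n ≠ 0 := fun h => by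
  simpa [h] using (isJacobiPoly_jacobiP hα hβ n).1.1

theorem jacobiInner_jacobiP_self_pos (hα : -1 < α) (hβ : -1 < β) (n : ℕ) :
    0 < jacobiInner α β (jacobiP α β n) (jacobiP α β n) :=
  jacobiInner_self_pos hα hβ (jacobiP_ne_zero hα hβ n)

theorem jacobiInner_jacobiP_self (hα : -1 < α) (hβ : -1 < β) {n : ℕ} (hn : n ≠ 0) :
    jacobiInner α β (jacobiP α β n) (jacobiP α β n) =
      2 ^ (α + β + 1) * Real.Gamma (n + (β + 1)) * Real.Gamma (n + (α + 1)) /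
        ((2 * n + α + β + 1) * n.factorial * Real.Gamma (n + (α + β + 1))) := by
  obtain ⟨n, rfl⟩ := Nat.exists_eq_succ_of_ne_zero hn
  have hP := isJacobiPoly_jacobiP hα hβ (n + 1)
  have hn : (0 : ℝ) ≤ n := n.cast_nonneg
  rw [Nat.succ_eq_add_one, jacobiInner_self_eq n hα hβ hP.1, hP.2, Real.Gamma_nat_eq_factorial]
  push_cast
  rw [show (n : ℝ) + 1 + α + 1 = n + α + 2 by ring, show (n : ℝ) + 1 + (α + 1) = n + α + 2 by ring,
    show (n : ℝ) + 1 + (β + 1) = n + β + 2 by ring,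
    show (n : ℝ) + 1 + (α + β + 1) = n + α + β + 2 by ring,
    show 2 * ((n : ℝ) + 1) + α + β + 1 = 2 * n + α + β + 3 by ring]
  have hG1 : 0 < Real.Gamma (α + 1) := Real.Gamma_pos_of_pos (by linarith)
  have hG2 : 0 < Real.Gamma (n + α + β + 2) := Real.Gamma_pos_of_pos (by linarith)
  have hG3 : 0 < Real.Gamma (n + α + 2) := Real.Gamma_pos_of_pos (by linarith)
  have hab : 2 * (n : ℝ) + α + β + 3 ≠ 0 := by linarith
  have : ((n + 1).factorial : ℝ) ≠ 0 := by exact_mod_cast (n + 1).factorial_ne_zero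
  field_simp

theorem isOrthogonalPoly_iterate_derivative (hα : -1 < α) (hβ : -1 < β) {n k : ℕ} {p : ℝ[X]}
    (hp : IsOrthogonalPoly (jacobiInner α β) (n + k) p) :
    IsOrthogonalPoly (jacobiInner (α + k) (β + k)) n (derivative^[k] p) := by
  induction k generalizing n with
  | zero => simpa using hp
  | succ k ih =>
    have hk : (0 : ℝ) ≤ k := k.cast_nonneg
    have := isOrthogonalPoly_derivative (by linarith) (by linarith)
      (ih (n := n + 1) (by rwa [add_assoc, add_comm 1]))
    rw [Function.iterate_succ_apply']
    push_cast
    rwa [← add_assoc, ← add_assoc]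

theorem eval_one_iterate_derivative_succ (hα : -1 < α) (hβ : -1 < β) {n k : ℕ} (hk : k ≤ n) :
    2 * (α + k + 1) * (derivative^[k + 1] (jacobiP α β n)).eval 1 =
      (n - k) * (n + k + α + β + 1) * (derivative^[k] (jacobiP α β n)).eval 1 := by
  have hk' : (0 : ℝ) ≤ k := k.cast_nonneg
  obtain ⟨d, rfl⟩ := Nat.exists_eq_add_of_le' hk
  have := eval_one_derivative (by linarith) (by linarith)
    (isOrthogonalPoly_iterate_derivative hα hβ (isJacobiPoly_jacobiP hα hβ (d + k)).1)
  rw [Function.iterate_succ_apply', this]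
  push_cast
  ring

/-! ### The reproducing kernel and the explicit form of `Q_n`. -/

/-- The `j`-th derivative of the reproducing kernel of the polynomials of degree less than `n`, taken
in one variable at the point `1`. -/
noncomputable def jacobiKernel (α β : ℝ) (j n : ℕ) : ℝ[X] :=
  ∑ i ∈ Finset.range n, ((derivative^[j] (jacobiP α β i)).eval 1 /
    jacobiInner α β (jacobiP α β i) (jacobiP α β i)) • jacobiP α β i

theorem eval_iterate_derivative_jacobiKernel (j k n : ℕ) :
    (derivative^[k] (jacobiKernel α β j n)).eval 1 =
      ∑ i ∈ Finset.range n, (derivative^[j] (jacobiP α β i)).eval 1 *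
        (derivative^[k] (jacobiP α β i)).eval 1 /
          jacobiInner α β (jacobiP α β i) (jacobiP α β i) := by
  simp only [jacobiKernel, iterate_derivative_sum, iterate_derivative_smul, eval_finsetSum,
    eval_smul, smul_eq_mul]
  exact Finset.sum_congr rfl fun _ _ => by ring

theorem degree_jacobiKernel_lt (hα : -1 < α) (hβ : -1 < β) (j n : ℕ) :
    (jacobiKernel α β j n).degree < n := by
  refine mem_degreeLT.1 (Submodule.sum_mem _ fun i hi => Submodule.smul_mem _ _ ?_)
  rw [mem_degreeLT, (isJacobiPoly_jacobiP hα hβ i).1.1]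
  exact_mod_cast Finset.mem_range.1 hi

theorem degree_sub_smul_lt {n : ℕ} {p q : ℝ[X]} (hp : p.degree = n) (hq : q.degree < (n + 1 : ℕ)) :
    (q - (q.coeff n / p.coeff n) • p).degree < n := by
  rw [degree_lt_iff_coeff_zero] at hq ⊢
  intro m hm
  rw [coeff_sub, coeff_smul, smul_eq_mul]
  rcases hm.eq_or_lt with rfl | h
  · rw [div_mul_cancel₀ _ (coeff_ne_zero_of_eq_degree hp), sub_self]
  · rw [hq m h, coeff_eq_zero_of_degree_lt (n := m) (by rw [hp]; exact_mod_cast h),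
      mul_zero, sub_zero]

theorem jacobiInner_jacobiKernel (hα : -1 < α) (hβ : -1 < β) (j n : ℕ) {q : ℝ[X]}
    (hq : q.degree < n) :
    jacobiInner α β (jacobiKernel α β j n) q = (derivative^[j] q).eval 1 := by
  induction n generalizing q with
  | zero =>
    have : q = 0 := by simpa using hq
    simp [this, jacobiInner]
  | succ n ih =>
    have hP := (isJacobiPoly_jacobiP hα hβ n).1
    have hr := degree_sub_smul_lt hP.1 hq
    set c := q.coeff n / (jacobiP α β n).coeff n
    set r := q - c • jacobiP α β n
    have hqr : q = r + c • jacobiP α β n := (sub_add_cancel _ _).symm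
    have hK : jacobiKernel α β j (n + 1) = jacobiKernel α β j n +
        ((derivative^[j] (jacobiP α β n)).eval 1 /
          jacobiInner α β (jacobiP α β n) (jacobiP α β n)) • jacobiP α β n :=
      Finset.sum_range_succ _ _
    have h0 := hP.2 _ (degree_jacobiKernel_lt hα hβ j n)
    rw [jacobiInner_comm, ← jacobiForm_apply hα hβ] at h0
    have h1 := ih hr
    have h2 := hP.2 r hr
    have h3 := (jacobiInner_jacobiP_self_pos hα hβ n).ne'
    rw [← jacobiForm_apply hα hβ] at h1 h2 ⊢
    rw [hK, hqr, iterate_map_add, iterate_derivative_smul, eval_add, eval_smul, ← h1]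
    simp only [map_add, map_smul, LinearMap.add_apply, LinearMap.smul_apply, h0, h2, smul_eq_mul]
    simp only [jacobiForm_apply]
    field_simp
    ring

theorem sobolevInner_add_left (hα : -1 < α) (hβ : -1 < β) (j : ℕ) (m : ℝ) (f g h : ℝ[X]) :
    sobolevInner α β j m (f + g) h = sobolevInner α β j m f h + sobolevInner α β j m g h := by
  simp only [sobolevInner, jacobiInner_add_left hα hβ, iterate_map_add, eval_add]
  ring

theorem sobolevInner_smul_left (j : ℕ) (m c : ℝ) (f g : ℝ[X]) :
    sobolevInner α β j m (c • f) g = c * sobolevInner α β j m f g := by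
  simp only [sobolevInner, jacobiInner_smul_left, iterate_derivative_smul, eval_smul, smul_eq_mul]
  ring

theorem sobolevInner_self_pos (hα : -1 < α) (hβ : -1 < β) (j : ℕ) {m : ℝ} (hm : 0 ≤ m) {f : ℝ[X]}
    (hf : f ≠ 0) : 0 < sobolevInner α β j m f f := by
  have := jacobiInner_self_pos hα hβ hf
  rw [sobolevInner, mul_assoc]
  have := mul_nonneg hm (mul_self_nonneg ((derivative^[j] f).eval 1))
  linarith

theorem eval_iterate_derivative_jacobiKernel_self_nonneg (hα : -1 < α) (hβ : -1 < β) (j n : ℕ) :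
    0 ≤ (derivative^[j] (jacobiKernel α β j n)).eval 1 := by
  rw [eval_iterate_derivative_jacobiKernel]
  exact Finset.sum_nonneg fun i _ =>
    div_nonneg (mul_self_nonneg _) (jacobiInner_jacobiP_self_pos hα hβ i).le

/-- Pairing `P_n - c K` with `q` gives `q⁽ʲ⁾(1)` times `m (P_n⁽ʲ⁾(1) - c K⁽ʲ⁾(1)) - c`; the
coefficient `c` is the root of this factor. -/
theorem isSobolevPoly_sub_smul_jacobiKernel (hα : -1 < α) (hβ : -1 < β) (j n : ℕ) {m : ℝ}
    (hm : 0 ≤ m) :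
    IsSobolevPoly α β j m n (jacobiP α β n -
      (m * (derivative^[j] (jacobiP α β n)).eval 1 /
        (1 + m * (derivative^[j] (jacobiKernel α β j n)).eval 1)) • jacobiKernel α β j n) := by
  have hP := (isJacobiPoly_jacobiP hα hβ n).1
  have hK0 := eval_iterate_derivative_jacobiKernel_self_nonneg hα hβ j n
  set K := jacobiKernel α β j n
  set c := m * (derivative^[j] (jacobiP α β n)).eval 1 / (1 + m * (derivative^[j] K).eval 1) with hc
  have hK : (c • K).degree < (jacobiP α β n).degree := by
    rw [hP.1]
    exact (degree_smul_le _ _).trans_lt (degree_jacobiKernel_lt hα hβ j n)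
  refine ⟨⟨by rw [degree_sub_eq_left_of_degree_lt hK, hP.1], fun q hq => ?_⟩,
    leadingCoeff_sub_of_degree_lt hK⟩
  rw [sub_eq_add_neg, ← neg_smul, sobolevInner_add_left hα hβ, sobolevInner_smul_left,
    sobolevInner, sobolevInner, hP.2 q hq, jacobiInner_jacobiKernel hα hβ j n hq, hc]
  have : 1 + m * (derivative^[j] K).eval 1 ≠ 0 := by positivity
  field_simp
  ring

theorem IsSobolevPoly.unique (hα : -1 < α) (hβ : -1 < β) {j n : ℕ} {m : ℝ} (hm : 0 ≤ m)
    {p q : ℝ[X]} (hp : IsSobolevPoly α β j m n p) (hq : IsSobolevPoly α β j m n q) : p = q := by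
  by_contra hne
  have hd : (p - q).degree < n := by
    have h := degree_sub_lt_left (hp.1.1.trans hq.1.1.symm)
      (fun h => by simpa [h] using hp.1.1) (hp.2.trans hq.2.symm)
    rwa [hp.1.1] at h
  refine (sobolevInner_self_pos hα hβ j hm (sub_ne_zero.2 hne)).ne' ?_
  rw [sub_eq_add_neg p, ← neg_one_smul ℝ q, sobolevInner_add_left hα hβ, sobolevInner_smul_left,
    neg_one_smul, ← sub_eq_add_neg, hp.1.2 _ hd, hq.1.2 _ hd]
  ring

theorem sobolevQ_eq (hα : -1 < α) (hβ : -1 < β) (j n : ℕ) {m : ℝ} (hm : 0 ≤ m) :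
    sobolevQ α β j m n = jacobiP α β n -
      (m * (derivative^[j] (jacobiP α β n)).eval 1 /
        (1 + m * (derivative^[j] (jacobiKernel α β j n)).eval 1)) • jacobiKernel α β j n := by
  have h := isSobolevPoly_sub_smul_jacobiKernel hα hβ j n hm
  exact (Classical.epsilon_spec (p := IsSobolevPoly α β j m n) ⟨_, h⟩).unique hα hβ hm h

theorem eval_iterate_derivative_sobolevQ (hα : -1 < α) (hβ : -1 < β) (j k n : ℕ) {m : ℝ}
    (hm : 0 ≤ m) :
    (derivative^[k] (sobolevQ α β j m n)).eval 1 = (derivative^[k] (jacobiP α β n)).eval 1 -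
      m * (derivative^[j] (jacobiP α β n)).eval 1 /
        (1 + m * (derivative^[j] (jacobiKernel α β j n)).eval 1) *
          (derivative^[k] (jacobiKernel α β j n)).eval 1 := by
  rw [sobolevQ_eq hα hβ j n hm, iterate_derivative_sub, iterate_derivative_smul, eval_sub,
    eval_smul, smul_eq_mul]

/-- Since `Q_n` is Sobolev-orthogonal to `K`, one factor `Q_n` may be replaced by `P_n`; since `P_n`
is Jacobi-orthogonal to `K`, the integral part is the norm of `P_n`. -/
theorem sobolevInner_sobolevQ_self (hα : -1 < α) (hβ : -1 < β) (j n : ℕ) {m : ℝ} (hm : 0 ≤ m) :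
    sobolevInner α β j m (sobolevQ α β j m n) (sobolevQ α β j m n) =
      jacobiInner α β (jacobiP α β n) (jacobiP α β n) +
        m * (derivative^[j] (jacobiP α β n)).eval 1 ^ 2 /
          (1 + m * (derivative^[j] (jacobiKernel α β j n)).eval 1) := by
  have hP := (isJacobiPoly_jacobiP hα hβ n).1
  have hK0 := eval_iterate_derivative_jacobiKernel_self_nonneg hα hβ j n
  have hQ := isSobolevPoly_sub_smul_jacobiKernel hα hβ j n hm
  have hQd := eval_iterate_derivative_sobolevQ hα hβ j j n hm
  rw [← sobolevQ_eq hα hβ j n hm] at hQ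
  have hKQ : sobolevInner α β j m (jacobiKernel α β j n) (sobolevQ α β j m n) = 0 := by
    have := hQ.1.2 _ (degree_jacobiKernel_lt hα hβ j n)
    rw [sobolevInner, jacobiInner_comm] at this
    rw [sobolevInner]
    linarith
  have hPQ : jacobiInner α β (jacobiP α β n) (sobolevQ α β j m n) =
      jacobiInner α β (jacobiP α β n) (jacobiP α β n) := by
    have h0 := hP.2 _ (degree_jacobiKernel_lt hα hβ j n)
    rw [sobolevQ_eq hα hβ j n hm]
    rw [← jacobiForm_apply hα hβ] at h0 ⊢
    rw [map_sub, map_smul, h0, smul_zero, sub_zero, jacobiForm_apply]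
  conv_lhs => arg 5; rw [sobolevQ_eq hα hβ j n hm]
  rw [sub_eq_add_neg, ← neg_smul, sobolevInner_add_left hα hβ, sobolevInner_smul_left, hKQ,
    sobolevInner, hPQ, hQd]
  have : 1 + m * (derivative^[j] (jacobiKernel α β j n)).eval 1 ≠ 0 := by positivity
  field_simp
  ring

end

/-! ### Asymptotics of Gamma quotients and of sums. -/

theorem tendsto_add_const_div_natCast (c : ℝ) :
    Tendsto (fun n : ℕ => ((n : ℝ) + c) / n) atTop (𝓝 1) := by
  have h : Tendsto (fun n : ℕ => 1 + c / (n : ℝ)) atTop (𝓝 (1 + 0)) :=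
    tendsto_const_nhds.add (tendsto_const_div_atTop_nhds_zero_nat c)
  rw [add_zero] at h
  refine h.congr' ?_
  filter_upwards [eventually_ne_atTop 0] with n hn
  have : (n : ℝ) ≠ 0 := by exact_mod_cast hn
  field_simp

theorem prod_range_add_natCast {s : ℝ} (hs : 0 < s) (n : ℕ) :
    ∏ i ∈ Finset.range n, (s + i) = Real.Gamma (n + s) / Real.Gamma s := by
  have hG := (Real.Gamma_pos_of_pos hs).ne'
  induction n with
  | zero => simp [hG]
  | succ n ih =>
    rw [Finset.prod_range_succ, ih]
    push_cast
    rw [show (n : ℝ) + 1 + s = n + s + 1 by ring, Real.Gamma_add_one (by positivity)]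
    ring

theorem tendsto_Gamma_natCast_add_div (s : ℝ) :
    Tendsto (fun n : ℕ => Real.Gamma (n + s) / (n.factorial * (n : ℝ) ^ (s - 1))) atTop (𝓝 1) := by
  -- Euler's limit for `Γ(s - 1)` settles `s > 1`. Smaller `s`, including the possibly negative `α +
  -- β + 1`, are reached by `d` uses of the functional equation.
  suffices H : ∀ d : ℕ, ∀ s : ℝ, 1 < s + d →
      Tendsto (fun n : ℕ => Real.Gamma (n + s) / (n.factorial * (n : ℝ) ^ (s - 1))) atTop (𝓝 1) by
    obtain ⟨d, hd⟩ := exists_nat_gt (1 - s)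
    exact H d s (by linarith)
  intro d
  induction d with
  | zero =>
    intro s hs
    have hs : 0 < s - 1 := by simpa using hs
    have hG := (Real.Gamma_pos_of_pos hs).ne'
    have h := ((Real.GammaSeq_tendsto_Gamma (s - 1)).div_const (Real.Gamma (s - 1))).inv₀
      (div_ne_zero hG hG)
    rw [div_self hG, inv_one] at h
    refine h.congr fun n => ?_
    rw [Real.GammaSeq, prod_range_add_natCast hs]
    push_cast
    rw [show (n : ℝ) + 1 + (s - 1) = n + s by ring, div_div, div_mul_cancel₀ _ hG, inv_div,
      mul_comm]
  | succ d ih =>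
    intro s hs
    push_cast at hs
    have h := (ih (s + 1) (by linarith)).div (tendsto_add_const_div_natCast s) one_ne_zero
    rw [div_one] at h
    refine h.congr' ?_
    filter_upwards [eventually_ne_atTop 0, tendsto_natCast_atTop_atTop.eventually_gt_atTop (-s)]
      with n hn hns
    have hn' : 0 < (n : ℝ) := by exact_mod_cast Nat.pos_of_ne_zero hn
    have hs' : (n : ℝ) + s ≠ 0 := by linarith
    have hf : (n.factorial : ℝ) ≠ 0 := by exact_mod_cast n.factorial_ne_zero
    have hp := (Real.rpow_pos_of_pos hn' (s - 1)).ne'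
    rw [Pi.div_apply, ← add_assoc, Real.Gamma_add_one hs', add_sub_right_comm, Real.rpow_add_one hn'.ne']
    field_simp

theorem tendsto_add_one_rpow_sub_rpow_div (s : ℝ) :
    Tendsto (fun n : ℕ => (((n : ℝ) + 1) ^ (s + 1) - (n : ℝ) ^ (s + 1)) / (n : ℝ) ^ s)
      atTop (𝓝 (s + 1)) := by
  have hd : HasDerivAt (fun x : ℝ => x ^ (s + 1)) (s + 1) 1 := by
    simpa using Real.hasDerivAt_rpow_const (x := 1) (p := s + 1) (Or.inl one_ne_zero)
  -- The quotient is the difference quotient of `x ^ (s + 1)` at `1` with increment `1/n`.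
  have ht : Tendsto (fun n : ℕ => ((n : ℝ))⁻¹) atTop (𝓝[≠] 0) := by
    refine tendsto_nhdsWithin_iff.2 ⟨tendsto_inv_atTop_nhds_zero_nat, ?_⟩
    filter_upwards [eventually_ne_atTop 0] with n hn
    simpa using hn
  refine ((hasDerivAt_iff_tendsto_slope_zero.1 hd).comp ht).congr' ?_
  filter_upwards [eventually_ne_atTop 0] with n hn
  have hn' : 0 < (n : ℝ) := by exact_mod_cast Nat.pos_of_ne_zero hn
  have hp := (Real.rpow_pos_of_pos hn' s).ne'
  have e : (1 : ℝ) + (n : ℝ)⁻¹ = (n + 1) / n := by field_simp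
  simp only [Function.comp_apply, inv_inv, smul_eq_mul, Real.one_rpow, e]
  rw [Real.div_rpow (by positivity) hn'.le, Real.rpow_add_one hn'.ne' s]
  field_simp

/-- Stolz–Cesàro: `a n` is compared with the increments `g n` of `n ^ (s + 1)`, whose sum telescopes
and diverges because `s > -1`. -/
theorem tendsto_sum_range_div_rpow {a : ℕ → ℝ} {s c : ℝ} (hs : -1 < s)
    (ha : Tendsto (fun n : ℕ => a n / (n : ℝ) ^ s) atTop (𝓝 c)) :
    Tendsto (fun n : ℕ => (∑ i ∈ Finset.range n, a i) / (n : ℝ) ^ (s + 1)) atTop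
      (𝓝 (c / (s + 1))) := by
  have hs1 : 0 < s + 1 := by linarith
  set g : ℕ → ℝ := fun n => ((n : ℝ) + 1) ^ (s + 1) - (n : ℝ) ^ (s + 1) with hg
  have hgpos : ∀ n, 0 < g n := fun n =>
    sub_pos.2 (Real.rpow_lt_rpow n.cast_nonneg (by linarith) hs1)
  have hsum : ∀ n, ∑ i ∈ Finset.range n, g i = (n : ℝ) ^ (s + 1) := fun n => by
    have := Finset.sum_range_sub (fun i : ℕ => (i : ℝ) ^ (s + 1)) n
    simpa [hg, Real.zero_rpow hs1.ne'] using this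
  have hag : Tendsto (fun n => a n / g n) atTop (𝓝 (c / (s + 1))) := by
    refine (ha.div (tendsto_add_one_rpow_sub_rpow_div s) hs1.ne').congr' ?_
    filter_upwards [eventually_ne_atTop 0] with n hn
    have hn' : 0 < (n : ℝ) := by exact_mod_cast Nat.pos_of_ne_zero hn
    exact div_div_div_cancel_right₀ (Real.rpow_pos_of_pos hn' s).ne' _ _
  have ho : (fun n => a n - c / (s + 1) * g n) =o[atTop] g := by
    refine (Asymptotics.isLittleO_iff_tendsto fun n h => absurd h (hgpos n).ne').2 ?_
    have := hag.sub_const (c / (s + 1))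
    rw [sub_self] at this
    refine this.congr fun n => ?_
    have := (hgpos n).ne'
    field_simp
  have hinf : Tendsto (fun n : ℕ => (n : ℝ) ^ (s + 1)) atTop atTop :=
    (tendsto_rpow_atTop hs1).comp tendsto_natCast_atTop_atTop
  have hO := ho.sum_range (fun n => (hgpos n).le) (by simpa only [hsum] using hinf)
  simp only [hsum, Finset.sum_sub_distrib, ← Finset.mul_sum] at hO
  have := hO.tendsto_div_nhds_zero.add_const (c / (s + 1))
  rw [zero_add] at this
  refine this.congr' ?_
  filter_upwards [eventually_ne_atTop 0] with n hn
  have hn' : 0 < (n : ℝ) := by exact_mod_cast Nat.pos_of_ne_zero hn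
  have := (Real.rpow_pos_of_pos hn' (s + 1)).ne'
  rw [sub_div, mul_div_cancel_right₀ _ this, sub_add_cancel]

/-! ### Asymptotics of `P_n`, its norm and the kernel. -/

section

variable {α β : ℝ}

theorem tendsto_eval_one_iterate_derivative_jacobiP (hα : -1 < α) (hβ : -1 < β) (k : ℕ) :
    Tendsto (fun n : ℕ => (derivative^[k] (jacobiP α β n)).eval 1 / (n : ℝ) ^ (2 * k + α)) atTop
      (𝓝 (1 / (2 ^ k * Real.Gamma (α + k + 1)))) := by
  induction k with
  | zero =>
    have h := (tendsto_Gamma_natCast_add_div (α + 1)).div_const (Real.Gamma (α + 1))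
    simp only [add_sub_cancel_right] at h
    simp only [Nat.cast_zero, mul_zero, zero_add, add_zero, pow_zero, one_mul,
      Function.iterate_zero, id]
    refine h.congr fun n => ?_
    rw [(isJacobiPoly_jacobiP hα hβ n).2, Real.Gamma_nat_eq_factorial, ← add_assoc]
    ring
  | succ k ih =>
    have hk : 0 < α + k + 1 := by
      have : (0 : ℝ) ≤ k := k.cast_nonneg
      linarith
    -- Each further derivative multiplies the value at `1` by `(n - k)(n + k + α + β + 1) / (2(α + k
    -- + 1))`.
    have h := (((tendsto_add_const_div_natCast (-k)).mul
      (tendsto_add_const_div_natCast (k + α + β + 1))).mul ih).div_const (2 * (α + k + 1))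
    have e : 1 * 1 * (1 / (2 ^ k * Real.Gamma (α + k + 1))) / (2 * (α + k + 1)) =
        1 / (2 ^ (k + 1) * Real.Gamma (α + (k + 1 : ℕ) + 1)) := by
      push_cast
      rw [← add_assoc, Real.Gamma_add_one hk.ne']
      have := (Real.Gamma_pos_of_pos hk).ne'
      field_simp
      ring
    rw [e] at h
    refine h.congr' ?_
    filter_upwards [eventually_ne_atTop 0, eventually_ge_atTop k] with n hn hkn
    have hn' : 0 < (n : ℝ) := by exact_mod_cast Nat.pos_of_ne_zero hn
    have hrec := eval_one_iterate_derivative_succ hα hβ hkn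
    have hD : (derivative^[k + 1] (jacobiP α β n)).eval 1 =
        (n - k) * (n + k + α + β + 1) * (derivative^[k] (jacobiP α β n)).eval 1 /
          (2 * (α + k + 1)) := by
      rw [eq_div_iff (by positivity), ← hrec]; ring
    have hp := (Real.rpow_pos_of_pos hn' (2 * k + α)).ne'
    rw [hD]
    push_cast
    rw [show 2 * ((k : ℝ) + 1) + α = 2 * k + α + 2 by ring, Real.rpow_add hn' (2 * k + α),
      Real.rpow_two]
    field_simp
    ring

theorem tendsto_jacobiInner_jacobiP_self (hα : -1 < α) (hβ : -1 < β) :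
    Tendsto (fun n : ℕ => jacobiInner α β (jacobiP α β n) (jacobiP α β n) * n) atTop
      (𝓝 (2 ^ (α + β))) := by
  have h := ((((tendsto_Gamma_natCast_add_div (β + 1)).mul
    (tendsto_Gamma_natCast_add_div (α + 1))).div
      (tendsto_Gamma_natCast_add_div (α + β + 1)) one_ne_zero).div
        (tendsto_add_const_div_natCast ((α + β + 1) / 2)) one_ne_zero).const_mul
          ((2 : ℝ) ^ (α + β))
  simp only [mul_one, div_one, add_sub_cancel_right] at h
  refine h.congr' ?_
  filter_upwards [eventually_ne_atTop 0] with n hn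
  have hn1 : 1 ≤ (n : ℝ) := by exact_mod_cast Nat.one_le_iff_ne_zero.2 hn
  have hn' : 0 < (n : ℝ) := by linarith
  have hf : (n.factorial : ℝ) ≠ 0 := by exact_mod_cast n.factorial_ne_zero
  have hpa := (Real.rpow_pos_of_pos hn' α).ne'
  have hpb := (Real.rpow_pos_of_pos hn' β).ne'
  have hG : Real.Gamma (n + (α + β + 1)) ≠ 0 := (Real.Gamma_pos_of_pos (by linarith)).ne'
  have h2 : 2 * (n : ℝ) + (α + β + 1) ≠ 0 := by linarith
  simp only [Pi.div_apply]
  rw [jacobiInner_jacobiP_self hα hβ hn, Real.rpow_add hn', Real.rpow_add_one two_ne_zero,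
    show 2 * (n : ℝ) + α + β + 1 = 2 * n + (α + β + 1) by ring,
    show (n : ℝ) + (α + β + 1) / 2 = (2 * n + (α + β + 1)) / 2 by ring]
  field_simp

theorem tendsto_jacobiKernel_term (hα : -1 < α) (hβ : -1 < β) (j k : ℕ) :
    Tendsto (fun n : ℕ => (derivative^[j] (jacobiP α β n)).eval 1 *
        (derivative^[k] (jacobiP α β n)).eval 1 /
          jacobiInner α β (jacobiP α β n) (jacobiP α β n) / (n : ℝ) ^ (2 * α + 2 * j + 2 * k + 1))
      atTop (𝓝 (1 / (2 ^ j * Real.Gamma (α + j + 1)) * (1 / (2 ^ k * Real.Gamma (α + k + 1))) /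
        2 ^ (α + β))) := by
  refine (((tendsto_eval_one_iterate_derivative_jacobiP hα hβ j).mul
    (tendsto_eval_one_iterate_derivative_jacobiP hα hβ k)).div
      (tendsto_jacobiInner_jacobiP_self hα hβ) (by positivity)).congr' ?_
  filter_upwards [eventually_ne_atTop 0] with n hn
  have hn' : 0 < (n : ℝ) := by exact_mod_cast Nat.pos_of_ne_zero hn
  simp only [Pi.div_apply]
  rw [show 2 * α + 2 * (j : ℝ) + 2 * k + 1 = (2 * j + α) + (2 * k + α) + 1 by ring,
    Real.rpow_add_one hn'.ne', Real.rpow_add hn' (2 * j + α)]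
  have := (jacobiInner_jacobiP_self_pos hα hβ n).ne'
  have := (Real.rpow_pos_of_pos hn' (2 * j + α)).ne'
  have := (Real.rpow_pos_of_pos hn' (2 * k + α)).ne'
  field_simp

theorem tendsto_eval_one_iterate_derivative_jacobiKernel (hα : -1 < α) (hβ : -1 < β) (j k : ℕ) :
    Tendsto (fun n : ℕ => (derivative^[k] (jacobiKernel α β j n)).eval 1 /
        (n : ℝ) ^ (2 * α + 2 * j + 2 * k + 2))
      atTop (𝓝 (1 / (2 ^ j * Real.Gamma (α + j + 1)) * (1 / (2 ^ k * Real.Gamma (α + k + 1))) /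
        2 ^ (α + β) / (2 * α + 2 * j + 2 * k + 2))) := by
  have hj : (0 : ℝ) ≤ j := j.cast_nonneg
  have hk : (0 : ℝ) ≤ k := k.cast_nonneg
  have := tendsto_sum_range_div_rpow (by linarith) (tendsto_jacobiKernel_term hα hβ j k)
  rw [add_assoc _ (1 : ℝ) 1, one_add_one_eq_two] at this
  simpa only [eval_iterate_derivative_jacobiKernel] using this

theorem tendsto_kernel_ratio (hα : -1 < α) (hβ : -1 < β) (j k : ℕ) :
    Tendsto (fun n : ℕ => (derivative^[j] (jacobiP α β n)).eval 1 *
        (derivative^[k] (jacobiKernel α β j n)).eval 1 / (derivative^[k] (jacobiP α β n)).eval 1 /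
          (n : ℝ) ^ (2 * (α + 2 * j + 1))) atTop
      (𝓝 (1 / (Real.Gamma (α + j + 1) ^ 2 * 2 ^ (α + β + 2 * j + 1) * (α + j + k + 1)))) := by
  have hj : (0 : ℝ) ≤ j := j.cast_nonneg
  have hk : (0 : ℝ) ≤ k := k.cast_nonneg
  have hGj : 0 < Real.Gamma (α + j + 1) := Real.Gamma_pos_of_pos (by linarith)
  have hGk : 0 < Real.Gamma (α + k + 1) := Real.Gamma_pos_of_pos (by linarith)
  have hjk : 0 < α + j + k + 1 := by linarith
  have h := ((tendsto_eval_one_iterate_derivative_jacobiP hα hβ j).mul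
    (tendsto_eval_one_iterate_derivative_jacobiKernel hα hβ j k)).div
      (tendsto_eval_one_iterate_derivative_jacobiP hα hβ k) (by positivity)
  have e : 1 / (2 ^ j * Real.Gamma (α + j + 1)) * (1 / (2 ^ j * Real.Gamma (α + j + 1)) *
      (1 / (2 ^ k * Real.Gamma (α + k + 1))) / 2 ^ (α + β) / (2 * α + 2 * j + 2 * k + 2)) /
        (1 / (2 ^ k * Real.Gamma (α + k + 1))) =
      1 / (Real.Gamma (α + j + 1) ^ 2 * 2 ^ (α + β + 2 * j + 1) * (α + j + k + 1)) := by
    rw [show 2 * α + 2 * (j : ℝ) + 2 * k + 2 = 2 * (α + j + k + 1) by ring,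
      Real.rpow_add_one two_ne_zero, Real.rpow_add two_pos (α + β), mul_comm (2 : ℝ) (j : ℝ),
      Real.rpow_mul two_pos.le, Real.rpow_natCast, Real.rpow_two]
    field_simp
  rw [e] at h
  refine h.congr' ?_
  filter_upwards [eventually_ne_atTop 0] with n hn
  have hn' : 0 < (n : ℝ) := by exact_mod_cast Nat.pos_of_ne_zero hn
  have h1 := (Real.rpow_pos_of_pos hn' (2 * j + α)).ne'
  have h2 := (Real.rpow_pos_of_pos hn' (2 * k + α)).ne'
  have h3 := (Real.rpow_pos_of_pos hn' (2 * (α + 2 * j + 1))).ne'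
  have h4 : (n : ℝ) ^ (2 * α + 2 * (j : ℝ) + 2 * k + 2) * n ^ (2 * j + α) =
      n ^ (2 * k + α) * n ^ (2 * (α + 2 * j + 1)) := by
    rw [← Real.rpow_add hn', ← Real.rpow_add hn']
    ring_nf
  have h5 : ∀ a b c x y z : ℝ, a / x * (b / y) / (c / z) = a * b / c * (z / (y * x)) :=
    fun a b c x y z => by
      rw [div_mul_div_comm, div_div_div_eq, div_mul_div_comm]
      ring
  rw [Pi.div_apply, h5, h4, div_mul_cancel_left₀ h2, ← div_eq_mul_inv]

/-- The numerator is the term of index `n` that would come next in the kernel sum; the sum is larger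
by a factor of order `n`. -/
theorem tendsto_sq_div_kernel (hα : -1 < α) (hβ : -1 < β) (j : ℕ) :
    Tendsto (fun n : ℕ => (derivative^[j] (jacobiP α β n)).eval 1 ^ 2 /
      jacobiInner α β (jacobiP α β n) (jacobiP α β n) /
        (derivative^[j] (jacobiKernel α β j n)).eval 1) atTop (𝓝 0) := by
  have hj : (0 : ℝ) ≤ j := j.cast_nonneg
  have hGj : 0 < Real.Gamma (α + j + 1) := Real.Gamma_pos_of_pos (by linarith)
  have hjj : 0 < 2 * α + 2 * j + 2 * j + 2 := by linarith
  have h := (((tendsto_jacobiKernel_term hα hβ j j).div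
    (tendsto_eval_one_iterate_derivative_jacobiKernel hα hβ j j) (by positivity))).mul
      (tendsto_inv_atTop_nhds_zero_nat (𝕜 := ℝ))
  rw [mul_zero] at h
  refine h.congr' ?_
  filter_upwards [eventually_ne_atTop 0] with n hn
  have hn' : 0 < (n : ℝ) := by exact_mod_cast Nat.pos_of_ne_zero hn
  have h1 := (Real.rpow_pos_of_pos hn' (2 * α + 2 * j + 2 * j + 1)).ne'
  simp only [Pi.div_apply]
  rw [show 2 * α + 2 * (j : ℝ) + 2 * j + 2 = 2 * α + 2 * j + 2 * j + 1 + 1 by ring,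
    Real.rpow_add_one hn'.ne' (2 * α + 2 * j + 2 * j + 1), sq]
  generalize (n : ℝ) ^ (2 * α + 2 * (j : ℝ) + 2 * j + 1) = y at h1 ⊢
  field_simp

end

/-! ### The three regimes of the mass and the conclusion. -/

theorem tendsto_mass_mul_rpow {γ M e : ℝ} {m : ℕ → ℝ}
    (hlim : Tendsto (fun n : ℕ => m n * (n : ℝ) ^ γ) atTop (𝓝 M)) :
    (γ = e → Tendsto (fun n : ℕ => m n * (n : ℝ) ^ e) atTop (𝓝 M)) ∧
    (e < γ → Tendsto (fun n : ℕ => m n * (n : ℝ) ^ e) atTop (𝓝 0)) ∧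
    (0 < M → γ < e → Tendsto (fun n : ℕ => m n * (n : ℝ) ^ e) atTop atTop) := by
  have h : (fun n : ℕ => m n * (n : ℝ) ^ γ * (n : ℝ) ^ (e - γ)) =ᶠ[atTop]
      fun n : ℕ => m n * (n : ℝ) ^ e := by
    filter_upwards [eventually_ne_atTop 0] with n hn
    have hn' : 0 < (n : ℝ) := by exact_mod_cast Nat.pos_of_ne_zero hn
    rw [mul_assoc, ← Real.rpow_add hn', add_sub_cancel]
  refine ⟨fun he => he ▸ hlim, fun he => ?_, fun hM he => ?_⟩
  · have h0 := (tendsto_rpow_neg_atTop (sub_pos.2 he)).comp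
      (tendsto_natCast_atTop_atTop (R := ℝ))
    rw [neg_sub] at h0
    simpa using (hlim.mul h0).congr' h
  · exact (hlim.pos_mul_atTop hM ((tendsto_rpow_atTop (sub_pos.2 he)).comp
      (tendsto_natCast_atTop_atTop (R := ℝ)))).congr' h

theorem tendsto_mul_div_one_add_mul_of_atTop {T A B : ℕ → ℝ} {a b : ℝ} (hb : b ≠ 0)
    (hT : Tendsto T atTop atTop) (hA : Tendsto A atTop (𝓝 a)) (hB : Tendsto B atTop (𝓝 b)) :
    Tendsto (fun n => T n * A n / (1 + T n * B n)) atTop (𝓝 (a / b)) := by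
  have h := hA.div (hT.inv_tendsto_atTop.add hB) (by simpa using hb)
  rw [zero_add] at h
  refine h.congr' ?_
  filter_upwards [hT.eventually_gt_atTop 0] with n hn
  have hn' := hn.ne'
  simp only [Pi.div_apply, Pi.inv_apply]
  rw [← mul_div_mul_left _ _ hn', mul_add, mul_inv_cancel₀ hn']

theorem tendsto_mul_div_one_add_mul {T A B : ℕ → ℝ} {t a b : ℝ} (ht : 0 ≤ t) (hb : 0 < b)
    (hT : Tendsto T atTop (𝓝 t)) (hA : Tendsto A atTop (𝓝 a)) (hB : Tendsto B atTop (𝓝 b)) :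
    Tendsto (fun n => T n * A n / (1 + T n * B n)) atTop (𝓝 (t * a / (1 + t * b))) :=
  (hT.mul hA).div (tendsto_const_nhds.add (hT.mul hB)) (by positivity)

theorem eventually_eval_one_iterate_derivative_jacobiP_ne_zero {α β : ℝ} (hα : -1 < α)
    (hβ : -1 < β) (k : ℕ) :
    ∀ᶠ n : ℕ in atTop, (derivative^[k] (jacobiP α β n)).eval 1 ≠ 0 := by
  have hk : (0 : ℝ) ≤ k := k.cast_nonneg
  have hG : 0 < Real.Gamma (α + k + 1) := Real.Gamma_pos_of_pos (by linarith)
  filter_upwards [(tendsto_eval_one_iterate_derivative_jacobiP hα hβ k).eventually_ne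
    (show 1 / (2 ^ k * Real.Gamma (α + k + 1)) ≠ 0 by positivity)] with n hn h
  exact hn (by rw [h, zero_div])

/-- The quotient of the derivatives at `1`, with the mass and the kernels rescaled by the power of
`n` that gives them limits. -/
theorem eventually_sobolevQ_div_jacobiP_eq {α β : ℝ} (hα : -1 < α) (hβ : -1 < β) (j k : ℕ)
    {m : ℕ → ℝ} (hm : ∀ n, 0 ≤ m n) :
    (fun n : ℕ => 1 - m n * (n : ℝ) ^ (2 * (α + 2 * j + 1)) *
      ((derivative^[j] (jacobiP α β n)).eval 1 * (derivative^[k] (jacobiKernel α β j n)).eval 1 /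
        (derivative^[k] (jacobiP α β n)).eval 1 / (n : ℝ) ^ (2 * (α + 2 * j + 1))) /
      (1 + m n * (n : ℝ) ^ (2 * (α + 2 * j + 1)) *
        ((derivative^[j] (jacobiP α β n)).eval 1 * (derivative^[j] (jacobiKernel α β j n)).eval 1 /
          (derivative^[j] (jacobiP α β n)).eval 1 / (n : ℝ) ^ (2 * (α + 2 * j + 1)))))
    =ᶠ[atTop] fun n : ℕ => (derivative^[k] (sobolevQ α β j (m n) n)).eval 1 /
      (derivative^[k] (jacobiP α β n)).eval 1 := by
  filter_upwards [eventually_ne_atTop 0,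
    eventually_eval_one_iterate_derivative_jacobiP_ne_zero hα hβ k,
    eventually_eval_one_iterate_derivative_jacobiP_ne_zero hα hβ j] with n hn hk hj
  have hn' : 0 < (n : ℝ) := by exact_mod_cast Nat.pos_of_ne_zero hn
  have hp := (Real.rpow_pos_of_pos hn' (2 * (α + 2 * j + 1))).ne'
  rw [eval_iterate_derivative_sobolevQ hα hβ j k n (hm n), mul_div_cancel_left₀ _ hj,
    mul_assoc (m n), mul_div_cancel₀ _ hp, mul_assoc (m n), mul_div_cancel₀ _ hp, sub_div,
    div_self hk]
  ring

theorem tendsto_sobolevInner_sobolevQ_div {α β : ℝ} (hα : -1 < α) (hβ : -1 < β) (j : ℕ)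
    {m : ℕ → ℝ} (hm : ∀ n, 0 ≤ m n) :
    Tendsto (fun n : ℕ =>
        sobolevInner α β j (m n) (sobolevQ α β j (m n) n) (sobolevQ α β j (m n) n) /
          jacobiInner α β (jacobiP α β n) (jacobiP α β n)) atTop (𝓝 1) := by
  have hj : (0 : ℝ) ≤ j := j.cast_nonneg
  have hG : 0 < Real.Gamma (α + j + 1) := Real.Gamma_pos_of_pos (by linarith)
  have hjj : 0 < 2 * α + 2 * j + 2 * j + 2 := by linarith
  refine tendsto_of_tendsto_of_tendsto_of_le_of_le' tendsto_const_nhds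
    (by simpa using (tendsto_sq_div_kernel hα hβ j).const_add 1) ?_ ?_
  · filter_upwards with n
    have hh := jacobiInner_jacobiP_self_pos hα hβ n
    have hK := eval_iterate_derivative_jacobiKernel_self_nonneg hα hβ j n
    have hmn := hm n
    rw [sobolevInner_sobolevQ_self hα hβ j n hmn, one_le_div hh]
    exact le_add_of_nonneg_right (by positivity)
  · filter_upwards [(tendsto_eval_one_iterate_derivative_jacobiKernel hα hβ j j).eventually_ne
      (show _ ≠ (0 : ℝ) by positivity)] with n hn
    have hh := jacobiInner_jacobiP_self_pos hα hβ n
    have hK := (eval_iterate_derivative_jacobiKernel_self_nonneg hα hβ j n).lt_of_ne'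
      (fun h => hn (by rw [h, zero_div]))
    have hmn := hm n
    rw [sobolevInner_sobolevQ_self hα hβ j n hmn, add_div, div_self hh.ne', div_right_comm]
    refine add_le_add_right ?_ 1
    have hy : 0 ≤ (derivative^[j] (jacobiP α β n)).eval 1 ^ 2 /
        jacobiInner α β (jacobiP α β n) (jacobiP α β n) := by positivity
    -- The bound is `m / (1 + m K⁽ʲ⁾(1)) ≤ 1 / K⁽ʲ⁾(1)`, uniform in the mass.
    rw [mul_div_assoc, div_le_div_iff₀ (by positivity) hK]
    linarith

theorem lemma1 (α β γ M : ℝ) (j : ℕ) (m : ℕ → ℝ)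
    (hα : -1 < α) (hβ : -1 < β) (hM : 0 < M) (hm : ∀ n, 0 ≤ m n)
    (hlim : Tendsto (fun n : ℕ => m n * (n : ℝ) ^ γ) atTop (𝓝 M)) :
    (∀ k : ℕ,
      (γ < 2 * (α + 2 * j + 1) →
        Tendsto (fun n : ℕ => (derivative^[k] (sobolevQ α β j (m n) n)).eval 1 /
            (derivative^[k] (jacobiP α β n)).eval 1) atTop
          (𝓝 (((k : ℝ) - j) / (α + j + k + 1)))) ∧
      (γ = 2 * (α + 2 * j + 1) →
        Tendsto (fun n : ℕ => (derivative^[k] (sobolevQ α β j (m n) n)).eval 1 /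
            (derivative^[k] (jacobiP α β n)).eval 1) atTop
          (𝓝 (thetaConst α β M j k))) ∧
      (2 * (α + 2 * j + 1) < γ →
        Tendsto (fun n : ℕ => (derivative^[k] (sobolevQ α β j (m n) n)).eval 1 /
            (derivative^[k] (jacobiP α β n)).eval 1) atTop (𝓝 1))) ∧
    Tendsto (fun n : ℕ =>
        sobolevInner α β j (m n) (sobolevQ α β j (m n) n) (sobolevQ α β j (m n) n) /
          jacobiInner α β (jacobiP α β n) (jacobiP α β n)) atTop (𝓝 1) := by
  refine ⟨fun k => ?_, tendsto_sobolevInner_sobolevQ_div hα hβ j hm⟩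
  have hj : (0 : ℝ) ≤ j := j.cast_nonneg
  have hk : (0 : ℝ) ≤ k := k.cast_nonneg
  have hG : 0 < Real.Gamma (α + j + 1) := Real.Gamma_pos_of_pos (by linarith)
  have hjj : 0 < α + 2 * j + 1 := by linarith
  have hjk : 0 < α + j + k + 1 := by linarith
  have hA := tendsto_kernel_ratio hα hβ j k
  -- For `k = j` the factor `P_n⁽ʲ⁾(1)` cancels, so the same lemma handles the denominator `1 + m
  -- K⁽ʲ⁾(1)`.
  have hB := tendsto_kernel_ratio hα hβ j j
  have hEq := eventually_sobolevQ_div_jacobiP_eq hα hβ j k hm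
  obtain ⟨hT₁, hT₂, hT₃⟩ := tendsto_mass_mul_rpow (e := 2 * (α + 2 * j + 1)) hlim
  rw [show α + j + j + 1 = α + 2 * j + 1 by ring] at hB
  set c := Real.Gamma (α + j + 1) ^ 2 * (2 : ℝ) ^ (α + β + 2 * j + 1) with hc
  have hc0 : 0 < c := by positivity
  refine ⟨fun h => ?_, fun h => ?_, fun h => ?_⟩
  -- With infinite rescaled mass only the ratio of kernel constants survives: the limit is `1 - (α +
  -- 2j + 1) / (α + j + k + 1)`.
  · have := ((tendsto_mul_div_one_add_mul_of_atTop (by positivity) (hT₃ hM h) hA hB).const_sub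
      1).congr' hEq
    convert this using 2
    field_simp
    ring
  · have := ((tendsto_mul_div_one_add_mul hM.le (by positivity) (hT₁ h) hA hB).const_sub
      1).congr' hEq
    convert this using 2
    have e : 1 + M * (1 / (c * (α + 2 * j + 1))) =
        (M + c * (α + 2 * j + 1)) / (c * (α + 2 * j + 1)) := by
      field_simp
      ring
    have hd : M + c * (α + 2 * j + 1) ≠ 0 := by positivity
    rw [thetaConst, ← hc, e]
    generalize hD : M + c * (α + 2 * j + 1) = D at hd ⊢
    field_simp
    rw [← hD]
    ring
  · have := ((tendsto_mul_div_one_add_mul le_rfl (by positivity) (hT₂ h) hA hB).const_sub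
      1).congr' hEq
    simpa using this
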